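/- Let $C$, $D$ and $E$ be abelian categories, where $C$ and $D$ have enough projectives, and let $F\colon C\times D\to E$ be a bifunctor, covariant and additive in each variable and right exact in each variable. For $n\ge 0$ let $F_n=L_nF\colon C\times D\to E$ be its left derived bifunctors, $F_n(X,Y)=H_n(\mathrm{Tot}\,F(P_\ast,Q_\ast))$ for projective resolutions $P_\ast\to X$, $Q_\ast\to Y$, and put $F_n=0$ for $n<0$. For a short exact sequence $0\to L\to M\to N\to 0$ in $C$ and $A\in D$, let $\delta_n\colon F_n(N,A)\to F_{n-1}(L,A)$ be the connecting morphism, obtained by resolving the sequence by a short exact sequence of projective resolutions, applying $\mathrm{Tot}\,F(-,Q_\ast)$ for a projective resolution $Q_\ast\to A$, and taking the connecting morphism in homology. Define $\delta_n\colon F_n(A,N)\to F_{n-1}(A,L)$ analogously for $A\in C$ and a short exact sequence in $D$. Let $I$ and $J$ be small categories, and let $F_n^{I\times J}\colon C^I\times D^J\to E^{I\times J}$ be the functor with components $F_n^{I\times J}(X,Y)^{(i,j)}=F_n(X^i,Y^j)$ on objects, and likewise on morphisms. (1) For every short exact sequence $0\to L\to M\to N\to 0$ in $C^I$, every $A\in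 D^J$ and every $n$, the connecting morphisms $\delta_n\colon F_n(N^i,A^j)\to F_{n-1}(L^i,A^j)$ of the component sequences $0\to L^i\to M^i\to N^i\to 0$ are the components of a morphism $\delta_n^{I\times J}\colon F_n^{I\times J}(N,A)\to F_{n-1}^{I\times J}(L,A)$ in $E^{I\times J}$. With these morphisms the following holds. For every morphism $$\begin{array}{ccccccccc}0&\to& L&\to& M&\to& N&\to&0\\&&\downarrow&&\downarrow&&\downarrow&&\\0&\to& L'&\to& M'&\to& N'&\to&0\end{array}$$ of short exact sequences in $C^I$ and every morphism $f\colon A\to B$ in $D^J$, the diagram $$\begin{array}{ccccccccccc}\cdots\to&F_{n+1}^{I\times J}(N,A)&\xrightarrow{\delta_{n+1}^{I\times J}}&F_n^{I\times J}(L,A)&\to&F_n^{I\times J}(M,A)&\to&F_n^{I\times J}(N,A)&\xrightarrow{\delta_n^{I\times J}}&F_{n-1}^{I\times J}(L,A)&\to\cdots\\&\downarrow&&\downarrow&&\downarrow&&\downarrow&&\downarrow&\\\cdots\to&F_{n+1}^{I\times J}(N',B)&\xrightarrow{\delta_{n+1}^{I\times J}}&F_n^{I\times J}(L',B)&\to&F_n^{I\times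 J}(M',B)&\to&F_n^{I\times J}(N',B)&\xrightarrow{\delta_n^{I\times J}}&F_{n-1}^{I\times J}(L',B)&\to\cdots\end{array}$$ commutes and its rows are exact. (2) The same holds with the variables switched: for every $A\in C^I$ and every short exact sequence $0\to L\to M\to N\to 0$ in $D^J$, the connecting morphisms $F_n(A^i,N^j)\to F_{n-1}(A^i,L^j)$ of the component sequences are the components of a morphism $\delta_n^{I\times J}\colon F_n^{I\times J}(A,N)\to F_{n-1}^{I\times J}(A,L)$ in $E^{I\times J}$. For every morphism from $0\to L\to M\to N\to 0$ to $0\to L'\to M'\to N'\to 0$ of short exact sequences in $D^J$ and every morphism $A\to B$ in $C^I$, the corresponding diagram, with upper row $\cdots\to F_{n+1}^{I\times J}(A,N)\to F_n^{I\times J}(A,L)\to F_n^{I\times J}(A,M)\to F_n^{I\times J}(A,N)\to F_{n-1}^{I\times J}(A,L)\to\cdots$ and lower row the one of $0\to L'\to M'\to N'\to 0$ and $B$, commutes and has exact rows. -/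

import Mathlib

open CategoryTheory CategoryTheory.Limits

universe v₁ v₂ v₃ u₁ u₂ u₃ w₁ w₂ t₁ t₂

namespace BifunctorHomology

section Total

variable {C : Type u₁} [Category.{v₁} C] [Abelian C]
  {D : Type u₂} [Category.{v₂} D] [Abelian D]
  {E : Type u₃} [Category.{v₃} E] [Abelian E]
  (F : C ⥤ D ⥤ E) [F.Additive] [∀ X, (F.obj X).Additive]

instance hasTotal (K : ChainComplex C ℕ) (L : ChainComplex D ℕ) :
    HomologicalComplex.HasMapBifunctor K L F (ComplexShape.down ℕ) := by
  intro n
  have : Finite ((ComplexShape.π (ComplexShape.down ℕ) (ComplexShape.down ℕ)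
      (ComplexShape.down ℕ)) ⁻¹' {n}) := by
    refine Set.Finite.subset (Finset.finite_toSet (Finset.HasAntidiagonal.antidiagonal n)) ?_
    rintro ⟨p, q⟩ h
    simpa using h
  infer_instance

/-- `Tot F(K, L)`: the total complex of the double complex `F(K_p, L_q)`,
as a bifunctor in the nonnegatively graded chain complexes `K` and `L`. -/
noncomputable abbrev tot : ChainComplex C ℕ ⥤ ChainComplex D ℕ ⥤ ChainComplex E ℕ :=
  F.map₂HomologicalComplex (ComplexShape.down ℕ) (ComplexShape.down ℕ) (ComplexShape.down ℕ)

/-- The morphism `Tot F(K, L)_n ⟶ Tot F(K', L')_n` given by a family of morphisms between the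
summands (not necessarily compatible with the differentials). -/
noncomputable def totMap {K K' : ChainComplex C ℕ} {L L' : ChainComplex D ℕ} (n : ℕ)
    (φ : ∀ p q, (F.obj (K.X p)).obj (L.X q) ⟶ (F.obj (K'.X p)).obj (L'.X q)) :
    (((tot F).obj K).obj L).X n ⟶ (((tot F).obj K').obj L').X n :=
  HomologicalComplex.mapBifunctorDesc (K₁ := K) (K₂ := L) (F := F) (c := ComplexShape.down ℕ)
    (fun p q h => φ p q ≫ HomologicalComplex.ιMapBifunctor K' L' F (ComplexShape.down ℕ) p q n h)

/-- The inclusion of the summand `F(K_p, L_q)` in `Tot F(K, L)_n`, for `p + q = n`. -/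
noncomputable def totι (K : ChainComplex C ℕ) (L : ChainComplex D ℕ) (p q n : ℕ) (h : p + q = n) :
    (F.obj (K.X p)).obj (L.X q) ⟶ (((tot F).obj K).obj L).X n :=
  HomologicalComplex.ιMapBifunctor K L F (ComplexShape.down ℕ) p q n h

section

variable {K K' K'' : ChainComplex C ℕ} {L L' L'' : ChainComplex D ℕ} (n : ℕ)

theorem tot_hom_ext {n : ℕ} {Y : E} {f g : (((tot F).obj K).obj L).X n ⟶ Y}
    (h : ∀ p q (h : p + q = n), totι F K L p q n h ≫ f = totι F K L p q n h ≫ g) : f = g :=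
  HomologicalComplex.mapBifunctor.hom_ext h

theorem ι_totMap (φ : ∀ p q, (F.obj (K.X p)).obj (L.X q) ⟶ (F.obj (K'.X p)).obj (L'.X q))
    (p q : ℕ) (h) :
    totι F K L p q n h ≫ totMap F n φ = φ p q ≫ totι F K' L' p q n h :=
  HomologicalComplex.ι_mapBifunctorDesc _ p q h

theorem totMap_comp (φ : ∀ p q, (F.obj (K.X p)).obj (L.X q) ⟶ (F.obj (K'.X p)).obj (L'.X q))
    (ψ : ∀ p q, (F.obj (K'.X p)).obj (L'.X q) ⟶ (F.obj (K''.X p)).obj (L''.X q)) :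
    totMap F n φ ≫ totMap F n ψ = totMap F n (fun p q => φ p q ≫ ψ p q) :=
  tot_hom_ext F fun p q h => by
    rw [← Category.assoc, ι_totMap, Category.assoc, ι_totMap, ι_totMap, Category.assoc]

theorem totMap_add (φ ψ : ∀ p q, (F.obj (K.X p)).obj (L.X q) ⟶ (F.obj (K'.X p)).obj (L'.X q)) :
    totMap F n φ + totMap F n ψ = totMap F n (fun p q => φ p q + ψ p q) :=
  tot_hom_ext F fun p q h => by
    rw [Preadditive.comp_add, ι_totMap, ι_totMap, ι_totMap, Preadditive.add_comp]

theorem totMap_id : totMap F n (fun p q => 𝟙 ((F.obj (K.X p)).obj (L.X q))) = 𝟙 _ :=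
  tot_hom_ext F fun p q h => by
    rw [ι_totMap, Category.id_comp, Category.comp_id]

theorem tot_map_app_f (f : K ⟶ K') (L : ChainComplex D ℕ) :
    (((tot F).map f).app L).f n = totMap F n (fun p q => (F.map (f.f p)).app (L.X q)) :=
  tot_hom_ext F fun p q h => by
    rw [ι_totMap]
    refine (HomologicalComplex.ι_mapBifunctorMap f (𝟙 L) F (ComplexShape.down ℕ) p q n h).trans ?_
    rw [HomologicalComplex.id_f, CategoryTheory.Functor.map_id, Category.id_comp]
    rfl

theorem tot_obj_map_f (K : ChainComplex C ℕ) (f : L ⟶ L') :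
    (((tot F).obj K).map f).f n = totMap F n (fun p q => (F.obj (K.X p)).map (f.f q)) :=
  tot_hom_ext F fun p q h => by
    rw [ι_totMap]
    refine (HomologicalComplex.ι_mapBifunctorMap (𝟙 K) f F (ComplexShape.down ℕ) p q n h).trans ?_
    rw [HomologicalComplex.id_f, CategoryTheory.Functor.map_id, NatTrans.id_app, Category.id_comp]
    rfl

end

instance tot_obj_additive (K : ChainComplex C ℕ) : ((tot F).obj K).Additive where
  map_add {_ _ f g} := by
    ext n
    rw [HomologicalComplex.add_f_apply, tot_obj_map_f, tot_obj_map_f, tot_obj_map_f, totMap_add]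
    simp

instance tot_flip_obj_additive (L : ChainComplex D ℕ) : ((tot F).flip.obj L).Additive where
  map_add {_ _ f g} := by
    ext n
    rw [HomologicalComplex.add_f_apply]
    simp only [Functor.flip_obj_map]
    rw [tot_map_app_f, tot_map_app_f, tot_map_app_f, totMap_add]
    simp

theorem exists_splitting {T : ShortComplex (ChainComplex C ℕ)} (hT : T.ShortExact)
    (hp : ∀ n, Projective (T.X₃.X n)) (p : ℕ) :
    ∃ (r : T.X₂.X p ⟶ T.X₁.X p) (s : T.X₃.X p ⟶ T.X₂.X p), T.f.f p ≫ r = 𝟙 _ ∧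
      s ≫ T.g.f p = 𝟙 _ ∧ r ≫ T.f.f p + T.g.f p ≫ s = 𝟙 _ := by
  have : Projective (T.map (HomologicalComplex.eval C _ p)).X₃ := hp p
  let σ := (hT.map_of_exact (HomologicalComplex.eval C _ p)).splittingOfProjective
  exact ⟨σ.r, σ.s, σ.f_r, σ.s_g, σ.id⟩

/-- If `0 ⟶ K₁ ⟶ K₂ ⟶ K₃ ⟶ 0` is exact and `K₃` consists of projective objects, then
`0 ⟶ Tot F(K₁, L) ⟶ Tot F(K₂, L) ⟶ Tot F(K₃, L) ⟶ 0` is exact. -/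
theorem tot_shortExact_left {T : ShortComplex (ChainComplex C ℕ)} (hT : T.ShortExact)
    (hp : ∀ n, Projective (T.X₃.X n)) (L : ChainComplex D ℕ) :
    (T.map ((tot F).flip.obj L)).ShortExact := by
  choose r s hr hs hrs using exists_splitting hT hp
  apply HomologicalComplex.shortExact_of_degreewise_shortExact
  intro n
  refine ShortComplex.Splitting.shortExact
    { r := totMap F n (fun p q => (F.map (r p)).app (L.X q))
      s := totMap F n (fun p q => (F.map (s p)).app (L.X q))
      f_r := ?_
      s_g := ?_
      id := ?_ }
  · refine (congr_arg (· ≫ _) (tot_map_app_f F n T.f L)).trans ((totMap_comp F n _ _).trans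
      (Eq.trans ?_ (totMap_id F n)))
    congr! with p q
    simpa only [Functor.map_comp, Functor.map_add, CategoryTheory.Functor.map_id, NatTrans.comp_app, NatTrans.app_add, NatTrans.id_app] using congr_arg (fun φ => (F.map φ).app (L.X q)) (hr p)
  · refine (congr_arg (_ ≫ ·) (tot_map_app_f F n T.g L)).trans ((totMap_comp F n _ _).trans
      (Eq.trans ?_ (totMap_id F n)))
    congr! with p q
    simpa only [Functor.map_comp, Functor.map_add, CategoryTheory.Functor.map_id, NatTrans.comp_app, NatTrans.app_add, NatTrans.id_app] using congr_arg (fun φ => (F.map φ).app (L.X q)) (hs p)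
  · refine (congr_arg₂ (· + ·) ((congr_arg (_ ≫ ·) (tot_map_app_f F n T.f L)).trans
      (totMap_comp F n _ _)) ((congr_arg (· ≫ _) (tot_map_app_f F n T.g L)).trans
      (totMap_comp F n _ _))).trans ((totMap_add F n _ _).trans (Eq.trans ?_ (totMap_id F n)))
    congr! with p q
    simpa only [Functor.map_comp, Functor.map_add, CategoryTheory.Functor.map_id, NatTrans.comp_app, NatTrans.app_add, NatTrans.id_app] using congr_arg (fun φ => (F.map φ).app (L.X q)) (hrs p)

/-- If `0 ⟶ L₁ ⟶ L₂ ⟶ L₃ ⟶ 0` is exact and `L₃` consists of projective objects, then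
`0 ⟶ Tot F(K, L₁) ⟶ Tot F(K, L₂) ⟶ Tot F(K, L₃) ⟶ 0` is exact. -/
theorem tot_shortExact_right {T : ShortComplex (ChainComplex D ℕ)} (hT : T.ShortExact)
    (hp : ∀ n, Projective (T.X₃.X n)) (K : ChainComplex C ℕ) :
    (T.map ((tot F).obj K)).ShortExact := by
  choose r s hr hs hrs using exists_splitting hT hp
  apply HomologicalComplex.shortExact_of_degreewise_shortExact
  intro n
  refine ShortComplex.Splitting.shortExact
    { r := totMap F n (fun p q => (F.obj (K.X p)).map (r q))
      s := totMap F n (fun p q => (F.obj (K.X p)).map (s q))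
      f_r := ?_
      s_g := ?_
      id := ?_ }
  · refine (congr_arg (· ≫ _) (tot_obj_map_f F n K T.f)).trans ((totMap_comp F n _ _).trans
      (Eq.trans ?_ (totMap_id F n)))
    congr! with p q
    simpa only [Functor.map_comp, Functor.map_add, CategoryTheory.Functor.map_id] using congr_arg (fun φ => (F.obj (K.X p)).map φ) (hr q)
  · refine (congr_arg (_ ≫ ·) (tot_obj_map_f F n K T.g)).trans ((totMap_comp F n _ _).trans
      (Eq.trans ?_ (totMap_id F n)))
    congr! with p q
    simpa only [Functor.map_comp, Functor.map_add, CategoryTheory.Functor.map_id] using congr_arg (fun φ => (F.obj (K.X p)).map φ) (hs q)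
  · refine (congr_arg₂ (· + ·) ((congr_arg (_ ≫ ·) (tot_obj_map_f F n K T.f)).trans
      (totMap_comp F n _ _)) ((congr_arg (· ≫ _) (tot_obj_map_f F n K T.g)).trans
      (totMap_comp F n _ _))).trans ((totMap_add F n _ _).trans (Eq.trans ?_ (totMap_id F n)))
    congr! with p q
    simpa only [Functor.map_comp, Functor.map_add, CategoryTheory.Functor.map_id] using congr_arg (fun φ => (F.obj (K.X p)).map φ) (hrs q)

theorem homologyMap_tot_left {K K' : ChainComplex C ℕ} {f f' : K ⟶ K'} (h : Homotopy f f')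
    (L : ChainComplex D ℕ) (n : ℕ) :
    HomologicalComplex.homologyMap (((tot F).map f).app L) n =
      HomologicalComplex.homologyMap (((tot F).map f').app L) n :=
  (HomologicalComplex.mapBifunctorMapHomotopy₁ h (𝟙 L) F (ComplexShape.down ℕ)).homologyMap_eq n

theorem homologyMap_tot_right (K : ChainComplex C ℕ) {L L' : ChainComplex D ℕ} {g g' : L ⟶ L'}
    (h : Homotopy g g') (n : ℕ) :
    HomologicalComplex.homologyMap (((tot F).obj K).map g) n =
      HomologicalComplex.homologyMap (((tot F).obj K).map g') n :=
  (HomologicalComplex.mapBifunctorMapHomotopy₂ (𝟙 K) h F (ComplexShape.down ℕ)).homologyMap_eq n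

end Total

section Horseshoe

variable {C : Type u₁} [Category.{v₁} C] [Abelian C]

/-- Given projective resolutions `P` of `S.X₁` and `Q` of `S.X₃`, a projective resolution of the
sequence `S` extending them: a projective resolution of `S.X₂` in a short exact sequence of
complexes `0 ⟶ P ⟶ mid ⟶ Q ⟶ 0` over `0 ⟶ S.X₁ ⟶ S.X₂ ⟶ S.X₃ ⟶ 0`. -/
structure SequenceResolution (S : ShortComplex C) (P : ProjectiveResolution S.X₁)
    (Q : ProjectiveResolution S.X₃) where
  mid : ProjectiveResolution S.X₂
  f : P.complex ⟶ mid.complex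
  g : mid.complex ⟶ Q.complex
  f_π : f ≫ mid.π = P.π ≫ (ChainComplex.single₀ C).map S.f
  g_π : g ≫ Q.π = mid.π ≫ (ChainComplex.single₀ C).map S.g
  zero : f ≫ g = 0
  shortExact : (ShortComplex.mk f g zero).ShortExact

/-- The augmentation `P_0 ⟶ X` of a projective resolution. -/
noncomputable def aug {X : C} (P : ProjectiveResolution X) : P.complex.X 0 ⟶ X := P.π.f 0

@[simp]
theorem d_aug {X : C} (P : ProjectiveResolution X) : P.complex.d 1 0 ≫ aug P = 0 :=
  P.complex_d_comp_π_f_zero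

theorem aug_exact {X : C} (P : ProjectiveResolution X) :
    (ShortComplex.mk (P.complex.d 1 0) (aug P) (d_aug P)).Exact :=
  P.exact₀

instance aug_epi {X : C} (P : ProjectiveResolution X) : Epi (aug P) :=
  inferInstanceAs (Epi (P.π.f 0))

/-- Existence of the off-diagonal parts of the augmentation and of the differential. -/
theorem exists_twist {S : ShortComplex C} (hS : S.ShortExact)
    (P : ProjectiveResolution S.X₁) (Q : ProjectiveResolution S.X₃) :
    ∃ (σ : Q.complex.X 0 ⟶ S.X₂) (τ : ∀ n, Q.complex.X (n + 1) ⟶ P.complex.X n),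
      σ ≫ S.g = aug Q ∧ τ 0 ≫ aug P ≫ S.f + Q.complex.d 1 0 ≫ σ = 0 ∧
      ∀ n, τ (n + 1) ≫ P.complex.d (n + 1) n + Q.complex.d (n + 2) (n + 1) ≫ τ n = 0 := by
  have := hS.epi_g
  have := hS.mono_f
  have hσ : Projective.factorThru (aug Q) S.g ≫ S.g = aug Q := Projective.factorThru_comp _ _
  generalize Projective.factorThru (aug Q) S.g = σ at hσ
  obtain ⟨τ₀, h₀⟩ : ∃ τ₀ : Q.complex.X 1 ⟶ P.complex.X 0,
      τ₀ ≫ aug P ≫ S.f + Q.complex.d 1 0 ≫ σ = 0 := by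
    have h : (-(Q.complex.d 1 0 ≫ σ)) ≫ S.g = 0 := by simp [hσ]
    refine ⟨Projective.factorThru (hS.exact.lift _ h) (aug P), ?_⟩
    rw [← Category.assoc, Projective.factorThru_comp, hS.exact.lift_f, neg_add_cancel]
  obtain ⟨τ₁, h₁⟩ : ∃ τ₁ : Q.complex.X 2 ⟶ P.complex.X 1,
      τ₁ ≫ P.complex.d 1 0 + Q.complex.d 2 1 ≫ τ₀ = 0 := by
    have h : (-(Q.complex.d 2 1 ≫ τ₀)) ≫ aug P = 0 := by
      rw [← cancel_mono S.f, Preadditive.neg_comp, Preadditive.neg_comp, Category.assoc,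
        Category.assoc, eq_neg_of_add_eq_zero_left h₀]
      simp
    exact ⟨(aug_exact P).liftFromProjective _ h, by
      rw [(aug_exact P).liftFromProjective_comp, neg_add_cancel]⟩
  have step : ∀ n (a : Q.complex.X (n + 1) ⟶ P.complex.X n)
      (b : Q.complex.X (n + 2) ⟶ P.complex.X (n + 1)),
      b ≫ P.complex.d (n + 1) n + Q.complex.d (n + 2) (n + 1) ≫ a = 0 →
      ∃ c : Q.complex.X (n + 3) ⟶ P.complex.X (n + 2),
        c ≫ P.complex.d (n + 2) (n + 1) + Q.complex.d (n + 3) (n + 2) ≫ b = 0 := by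
    intro n a b hab
    have h : (-(Q.complex.d (n + 3) (n + 2) ≫ b)) ≫ P.complex.d (n + 1) n = 0 := by
      rw [Preadditive.neg_comp, Category.assoc, eq_neg_of_add_eq_zero_left hab]
      simp
    exact ⟨(P.exact_succ n).liftFromProjective _ h, by
      rw [(P.exact_succ n).liftFromProjective_comp, neg_add_cancel]⟩
  choose c hc using step
  let w : ∀ n, Σ' (a : Q.complex.X (n + 1) ⟶ P.complex.X n)
      (b : Q.complex.X (n + 2) ⟶ P.complex.X (n + 1)),
      b ≫ P.complex.d (n + 1) n + Q.complex.d (n + 2) (n + 1) ≫ a = 0 := fun n =>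
    Nat.rec ⟨τ₀, τ₁, h₁⟩ (fun n x => ⟨x.2.1, c n x.1 x.2.1 x.2.2, hc n x.1 x.2.1 x.2.2⟩) n
  exact ⟨σ, fun n => (w n).1, hσ, h₀, fun n => (w n).2.2⟩

/-- The complex with terms `P_n ⊕ Q_n` and an upper triangular differential. -/
theorem exists_twisted_complex (P Q : ChainComplex C ℕ) (τ : ∀ n, Q.X (n + 1) ⟶ P.X n)
    (hτ : ∀ n, τ (n + 1) ≫ P.d (n + 1) n + Q.d (n + 2) (n + 1) ≫ τ n = 0) :
    ∃ (R : ChainComplex C ℕ) (inl : ∀ n, P.X n ⟶ R.X n) (inr : ∀ n, Q.X n ⟶ R.X n)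
      (fst : ∀ n, R.X n ⟶ P.X n) (snd : ∀ n, R.X n ⟶ Q.X n),
      (∀ n, Nonempty (P.X n ⊞ Q.X n ≅ R.X n)) ∧
      (∀ n, inl n ≫ fst n = 𝟙 _) ∧ (∀ n, inl n ≫ snd n = 0) ∧
      (∀ n, inr n ≫ snd n = 𝟙 _) ∧
      (∀ n, fst n ≫ inl n + snd n ≫ inr n = 𝟙 _) ∧
      (∀ n, inl (n + 1) ≫ R.d (n + 1) n = P.d (n + 1) n ≫ inl n) ∧
      (∀ n, inr (n + 1) ≫ R.d (n + 1) n = τ n ≫ inl n + Q.d (n + 1) n ≫ inr n) := by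
  let d : ∀ n, P.X (n + 1) ⊞ Q.X (n + 1) ⟶ P.X n ⊞ Q.X n := fun n =>
    biprod.desc (P.d (n + 1) n ≫ biprod.inl) (τ n ≫ biprod.inl + Q.d (n + 1) n ≫ biprod.inr)
  have hd : ∀ n, d (n + 1) ≫ d n = 0 := fun n => by
    have h := congr_arg (· ≫ (biprod.inl : _ ⟶ P.X n ⊞ Q.X n)) (hτ n)
    simp only [Preadditive.add_comp, Category.assoc, zero_comp] at h
    ext1
    · simp [d]
    · simpa [d] using h
  have hR : ∀ n, (ChainComplex.of (fun n => P.X n ⊞ Q.X n) d hd).d (n + 1) n = d n :=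
    fun n => ChainComplex.of_d (fun n => P.X n ⊞ Q.X n) d n
  refine ⟨ChainComplex.of (fun n => P.X n ⊞ Q.X n) d hd,
    fun n => (biprod.inl : P.X n ⟶ P.X n ⊞ Q.X n), fun n => (biprod.inr : Q.X n ⟶ P.X n ⊞ Q.X n),
    fun n => (biprod.fst : P.X n ⊞ Q.X n ⟶ P.X n), fun n => (biprod.snd : P.X n ⊞ Q.X n ⟶ Q.X n),
    fun n => ⟨Iso.refl _⟩, fun n => biprod.inl_fst, fun n => biprod.inl_snd,
    fun n => biprod.inr_snd, fun n => biprod.total, fun n => ?_, fun n => ?_⟩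
  · exact (congr_arg (fun x => (biprod.inl : P.X (n + 1) ⟶ P.X (n + 1) ⊞ Q.X (n + 1)) ≫ x)
      (hR n)).trans (biprod.inl_desc _ _)
  · exact (congr_arg (fun x => (biprod.inr : Q.X (n + 1) ⟶ P.X (n + 1) ⊞ Q.X (n + 1)) ≫ x)
      (hR n)).trans (biprod.inr_desc _ _)

/-- The horseshoe lemma. -/
theorem nonempty_sequenceResolution {S : ShortComplex C} (hS : S.ShortExact)
    (P : ProjectiveResolution S.X₁) (Q : ProjectiveResolution S.X₃) :
    Nonempty (SequenceResolution S P Q) := by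
  obtain ⟨σ, τ, hσ, h₀, hτ⟩ := exists_twist hS P Q
  have := hS.epi_g
  have := hS.mono_f
  obtain ⟨R, inl, inr, fst, snd, iso, inl_fst, inl_snd, inr_snd, total, inl_d, inr_d⟩ :=
    exists_twisted_complex P.complex Q.complex τ hτ
  have hom_ext : ∀ n {Y : C} (a b : R.X n ⟶ Y), inl n ≫ a = inl n ≫ b → inr n ≫ a = inr n ≫ b →
      a = b := fun n Y a b h₁ h₂ => by
    rw [← Category.id_comp a, ← Category.id_comp b, ← total, Preadditive.add_comp,
      Preadditive.add_comp, Category.assoc, Category.assoc, Category.assoc, Category.assoc, h₁, h₂]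
  have snd_d : ∀ n, snd (n + 1) ≫ Q.complex.d (n + 1) n = R.d (n + 1) n ≫ snd n := fun n => by
    apply hom_ext
    · rw [reassoc_of% inl_snd, reassoc_of% inl_d, inl_snd, comp_zero, zero_comp]
    · rw [reassoc_of% inr_snd, reassoc_of% inr_d, Preadditive.add_comp, Category.assoc,
        Category.assoc, inl_snd, inr_snd, comp_zero, zero_add, Category.comp_id]
  have inr_fst : ∀ n, inr n ≫ fst n = 0 := fun n => by
    have h := congr_arg (fun x => inr n ≫ x ≫ fst n) (total n)
    simpa [inl_fst, reassoc_of% inr_snd] using h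
  let ε : R.X 0 ⟶ S.X₂ := fst 0 ≫ aug P ≫ S.f + snd 0 ≫ σ
  have inl_ε : inl 0 ≫ ε = aug P ≫ S.f := by
    simp [ε, reassoc_of% inl_fst, reassoc_of% inl_snd]
  have inr_ε : inr 0 ≫ ε = σ := by
    simp [ε, reassoc_of% inr_fst, reassoc_of% inr_snd]
  have ε_g : ε ≫ S.g = snd 0 ≫ aug Q := by
    simp [ε, hσ]
  have hε : R.d 1 0 ≫ ε = 0 := by
    apply hom_ext
    · rw [reassoc_of% inl_d, inl_ε, reassoc_of% (d_aug P), zero_comp, comp_zero]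
    · rw [reassoc_of% inr_d, Preadditive.add_comp, Category.assoc, Category.assoc, inl_ε, inr_ε,
        h₀, comp_zero]
  clear_value ε
  let i : P.complex ⟶ R := ChainComplex.ofHom inl inl_d
  let p : R ⟶ Q.complex := ChainComplex.ofHom snd snd_d
  have hip : i ≫ p = 0 := by
    ext n
    exact inl_snd n
  have hse : (ShortComplex.mk i p hip).ShortExact := by
    apply HomologicalComplex.shortExact_of_degreewise_shortExact
    intro n
    exact ShortComplex.Splitting.shortExact
      { r := fst n
        s := inr n
        f_r := inl_fst n
        s_g := inr_snd n
        id := total n }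
  have epi_ε : Epi ε := by
    apply Preadditive.epi_of_cancel_zero
    intro Y h hh
    have h₁ : S.f ≫ h = 0 := by
      rw [← cancel_epi (aug P), comp_zero, ← Category.assoc, ← inl_ε, Category.assoc, hh, comp_zero]
    have h₂ : S.g ≫ hS.exact.desc h h₁ = h := hS.exact.g_desc h h₁
    have h₃ : hS.exact.desc h h₁ = 0 := by
      rw [← cancel_epi (aug Q), comp_zero, ← hσ, Category.assoc, h₂, ← inr_ε, Category.assoc, hh,
        comp_zero]
    rw [← h₂, h₃, comp_zero]
  have hex : (ShortComplex.mk (R.d 1 0) ε hε).Exact := by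
    rw [ShortComplex.exact_iff_exact_up_to_refinements]
    intro A x hx
    dsimp at x hx ⊢
    have h₁ : (x ≫ snd 0) ≫ aug Q = 0 := by
      rw [Category.assoc, ← ε_g, reassoc_of% hx, zero_comp]
    obtain ⟨A', a, _, q, hq⟩ := (aug_exact Q).exact_up_to_refinements _ h₁
    have h₂ : (a ≫ x - q ≫ inr 1 ≫ R.d 1 0) ≫ snd 0 = 0 := by
      rw [Preadditive.sub_comp, Category.assoc, Category.assoc, Category.assoc, hq, ← snd_d,
        reassoc_of% inr_snd, sub_self]
    have h₃ : ((a ≫ x - q ≫ inr 1 ≫ R.d 1 0) ≫ fst 0) ≫ inl 0 = a ≫ x - q ≫ inr 1 ≫ R.d 1 0 := by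
      have := congr_arg (fun y => (a ≫ x - q ≫ inr 1 ≫ R.d 1 0) ≫ y) (total 0)
      dsimp only at this
      rwa [Preadditive.comp_add, reassoc_of% h₂, zero_comp, add_zero, Category.comp_id,
        ← Category.assoc] at this
    have h₄ : ((a ≫ x - q ≫ inr 1 ≫ R.d 1 0) ≫ fst 0) ≫ aug P = 0 := by
      rw [← cancel_mono S.f, Category.assoc, ← inl_ε, ← Category.assoc _ (inl 0), h₃, Preadditive.sub_comp,
        Category.assoc, Category.assoc, Category.assoc, hx, hε]
      simp
    obtain ⟨A'', b, _, z, hz⟩ := (aug_exact P).exact_up_to_refinements _ h₄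
    refine ⟨A'', b ≫ a, inferInstance, z ≫ inl 1 + b ≫ q ≫ inr 1, ?_⟩
    have h₅ := congr_arg (· ≫ inl 0) hz
    dsimp only at h₅
    rw [Category.assoc, h₃, Category.assoc, ← inl_d, Preadditive.comp_sub, sub_eq_iff_eq_add] at h₅
    simpa [Preadditive.add_comp] using h₅
  let π : R ⟶ (ChainComplex.single₀ C).obj S.X₂ :=
    (ChainComplex.toSingle₀Equiv R S.X₂).symm ⟨ε, hε⟩
  have hπ : π.f 0 = ε := ChainComplex.toSingle₀Equiv_symm_apply_f_zero _ hε
  have hq : QuasiIso π := by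
    refine ⟨fun n => ?_⟩
    cases n with
    | zero =>
      rw [ChainComplex.quasiIsoAt₀_iff, ShortComplex.quasiIso_iff_of_zeros']
      · refine (ShortComplex.exact_and_epi_g_iff_of_iso ?_).2 ⟨hex, epi_ε⟩
        exact ShortComplex.isoMk (Iso.refl _) (Iso.refl _) (Iso.refl _)
          ((Category.id_comp _).trans (Category.comp_id _).symm)
          ((Category.id_comp _).trans (hπ.symm.trans (Category.comp_id _).symm))
      all_goals first | rfl | exact R.shape 0 0 (by simp)
    | succ n =>
      rw [quasiIsoAt_iff_exactAt' _ _ (ChainComplex.exactAt_succ_single_obj _ _)]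
      exact hse.exactAt_X₂ _ (P.complex_exactAt_succ n) (Q.complex_exactAt_succ n)
  exact ⟨{
    mid := { complex := R, projective := fun n => Projective.of_iso (iso n).some inferInstance,
             π := π, quasiIso := hq }
    f := i
    g := p
    f_π := by
      refine HomologicalComplex.to_single_hom_ext ?_
      exact (congr_arg (inl 0 ≫ ·) hπ).trans (inl_ε.trans
        (congr_arg (aug P ≫ ·) (ChainComplex.single₀_map_f_zero S.f).symm))
    g_π := by
      refine HomologicalComplex.to_single_hom_ext ?_
      exact ε_g.symm.trans (congr_arg₂ (· ≫ ·) hπ.symm (ChainComplex.single₀_map_f_zero S.g).symm)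
    zero := hip
    shortExact := hse }⟩

end Horseshoe

section Derived

variable {C : Type u₁} [Category.{v₁} C] [Abelian C] [EnoughProjectives C]
  {D : Type u₂} [Category.{v₂} D] [Abelian D] [EnoughProjectives D]
  {E : Type u₃} [Category.{v₃} E] [Abelian E]
  (F : C ⥤ D ⥤ E) [F.Additive] [∀ X, (F.obj X).Additive]

/-- The `n`-th left derived bifunctor `F_n` of `F`, taken in both variables simultaneously:
`F_n(X, Y) = H_n(Tot F(P, Q))` where `P ⟶ X` and `Q ⟶ Y` are (chosen) projective resolutions.
On morphisms it is given by lifting them to the resolutions. -/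
noncomputable def derived (n : ℕ) : C ⥤ D ⥤ E where
  obj X :=
    { obj Y := (((tot F).obj (projectiveResolution X).complex).obj
        (projectiveResolution Y).complex).homology n
      map {Y Y'} g := HomologicalComplex.homologyMap
        (((tot F).obj (projectiveResolution X).complex).map
          (ProjectiveResolution.lift g (projectiveResolution Y) (projectiveResolution Y'))) n
      map_id Y := by
        rw [homologyMap_tot_right F _ (ProjectiveResolution.liftIdHomotopy Y _) n,
          CategoryTheory.Functor.map_id, HomologicalComplex.homologyMap_id]
      map_comp {Y Y' Y''} g g' := by
        rw [homologyMap_tot_right F _ (ProjectiveResolution.liftCompHomotopy g g'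
          (projectiveResolution Y) (projectiveResolution Y') (projectiveResolution Y'')) n,
          Functor.map_comp, HomologicalComplex.homologyMap_comp] }
  map {X X'} f :=
    { app Y := HomologicalComplex.homologyMap (((tot F).map
        (ProjectiveResolution.lift f (projectiveResolution X) (projectiveResolution X'))).app
          (projectiveResolution Y).complex) n
      naturality {Y Y'} g := by
        dsimp only
        rw [← HomologicalComplex.homologyMap_comp, NatTrans.naturality,
          HomologicalComplex.homologyMap_comp] }
  map_id X := by
    ext Y
    dsimp only
    rw [homologyMap_tot_left F (ProjectiveResolution.liftIdHomotopy X _) _ n,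
      CategoryTheory.Functor.map_id, NatTrans.id_app, HomologicalComplex.homologyMap_id]
    rfl
  map_comp {X X' X''} f f' := by
    ext Y
    dsimp only [NatTrans.comp_app]
    rw [homologyMap_tot_left F (ProjectiveResolution.liftCompHomotopy f f'
      (projectiveResolution X) (projectiveResolution X') (projectiveResolution X'')) _ n,
      Functor.map_comp, NatTrans.comp_app, HomologicalComplex.homologyMap_comp]

/-- The connecting morphism `δ_{n+1} : F_{n+1}(N, A) ⟶ F_n(L, A)` of a short exact sequence
`0 ⟶ L ⟶ M ⟶ N ⟶ 0` in the first variable: resolve the sequence by a short exact sequence of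
projective resolutions, apply `Tot F(-, Q)` for the projective resolution `Q` of `A`, and take the
connecting morphism in homology. -/
noncomputable def connectingLeft {S : ShortComplex C} (hS : S.ShortExact) (A : D) (n : ℕ) :
    ((derived F (n + 1)).obj S.X₃).obj A ⟶ ((derived F n).obj S.X₁).obj A :=
  let R := (nonempty_sequenceResolution hS
    (projectiveResolution S.X₁) (projectiveResolution S.X₃)).some
  (tot_shortExact_left F R.shortExact (projectiveResolution S.X₃).projective
    (projectiveResolution A).complex).δ (n + 1) n rfl

/-- The connecting morphism `δ_{n+1} : F_{n+1}(A, N) ⟶ F_n(A, L)` of a short exact sequence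
`0 ⟶ L ⟶ M ⟶ N ⟶ 0` in the second variable. -/
noncomputable def connectingRight (A : C) {S : ShortComplex D} (hS : S.ShortExact) (n : ℕ) :
    ((derived F (n + 1)).obj A).obj S.X₃ ⟶ ((derived F n).obj A).obj S.X₁ :=
  let R := (nonempty_sequenceResolution hS
    (projectiveResolution S.X₁) (projectiveResolution S.X₃)).some
  (tot_shortExact_right F R.shortExact (projectiveResolution S.X₃).projective
    (projectiveResolution A).complex).δ (n + 1) n rfl

end Derived

section Exponent

variable {C : Type u₁} [Category.{v₁} C] {D : Type u₂} [Category.{v₂} D]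
  {E : Type u₃} [Category.{v₃} E]

/-- The exponent `G^{I × J} : C^I × D^J ⟶ E^{I × J}` of a bifunctor `G`:
`G^{I × J}(X, Y)` has the components `G(X^i, Y^j)`, and likewise on morphisms. -/
def exponent (G : C ⥤ D ⥤ E) (I : Type t₁) [Category.{w₁} I] (J : Type t₂) [Category.{w₂} J] :
    (I ⥤ C) ⥤ (J ⥤ D) ⥤ (I × J ⥤ E) where
  obj X :=
    { obj Y :=
        { obj k := (G.obj (X.obj k.1)).obj (Y.obj k.2)
          map {k l} a := (G.map (X.map a.1)).app (Y.obj k.2) ≫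
            (G.obj (X.obj l.1)).map (Y.map a.2)
          map_id k := by
            simp
          map_comp {k l m} a b := by
            simp }
      map {Y Y'} g :=
        { app k := (G.obj (X.obj k.1)).map (g.app k.2)
          naturality {k l} a := by
            simp only [Category.assoc, NatTrans.naturality_assoc, ← Functor.map_comp,
              NatTrans.naturality] }
      map_id Y := by
        ext k
        simp
      map_comp {Y Y' Y''} g g' := by
        ext k
        simp }
  map {X X'} f :=
    { app Y :=
        { app k := (G.map (f.app k.1)).app (Y.obj k.2)
          naturality {k l} a := by
            simp only [Category.assoc, NatTrans.naturality]
            simp only [← Category.assoc, ← NatTrans.comp_app, ← Functor.map_comp,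
              NatTrans.naturality] }
      naturality {Y Y'} g := by
        ext k
        simp }
  map_id X := by
    ext Y k
    simp
  map_comp {X X' X''} f f' := by
    ext Y k
    simp

/-- The morphism `G(X, Y) ⟶ G(X', Y')` induced by `f : X ⟶ X'` and `g : Y ⟶ Y'`. -/
def bimap (G : C ⥤ D ⥤ E) {X X' : C} (f : X ⟶ X') {Y Y' : D} (g : Y ⟶ Y') :
    (G.obj X).obj Y ⟶ (G.obj X').obj Y' :=
  (G.map f).app Y ≫ (G.obj X').map g

end Exponent

/-- The sequence `X ⟶ Y ⟶ Z` is exact at `Y` (in particular its composite vanishes). -/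
def ExactAtMiddle {A : Type u₁} [Category.{v₁} A] [Abelian A] {X Y Z : A}
    (f : X ⟶ Y) (g : Y ⟶ Z) : Prop :=
  ∃ w : f ≫ g = 0, (ShortComplex.mk f g w).Exact

end BifunctorHomology

/-! Exactness and commutativity in `I × J ⥤ E` are tested on components, so the theorem reduces to
the long exact sequence of `F_n` for one short exact sequence and to its naturality in both
variables at once. Naturality is needed twice: for the vertical squares, and for the morphisms `X^i
⟶ X^l` coming from arrows of `I` and `J`, which turn the component connecting morphisms into a
natural transformation.

The long exact sequence is the homology sequence of the total complexes of a horseshoe resolution `0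
⟶ P ⟶ mid ⟶ Q ⟶ 0`. Since `mid` is in general not the chosen resolution of the middle object, its
homology is replaced along the isomorphism `homologyIso`, using that `Tot F` respects homotopies in
each variable.

Naturality in the variable of the sequence rests on `exists_lift`: a morphism of short exact
sequences lifts to the given horseshoe resolutions. A lift of the middle map need not preserve the
subcomplexes, but the obstruction `P ⟶ Q'` covers zero, hence is null-homotopic, and the homotopy
can be moved to the middle by degreewise splittings and subtracted. Naturality in the other variable
is naturality for a transformation between two functors applied to one fixed sequence of resolutions
(`δ_natTrans`). -/

namespace BifunctorHomology

/-! ### Lifting morphisms of short exact sequences to horseshoe resolutions. -/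

section Comparison

variable {C : Type u₁} [Category.{v₁} C] [Abelian C]

namespace SequenceResolution

/-- The short exact sequence of complexes `0 ⟶ P ⟶ mid ⟶ Q ⟶ 0`. -/
abbrev shortComplex {S : ShortComplex C} {P : ProjectiveResolution S.X₁}
    {Q : ProjectiveResolution S.X₃} (R : SequenceResolution S P Q) :
    ShortComplex (ChainComplex C ℕ) :=
  ShortComplex.mk R.f R.g R.zero

/-- A lift of a morphism of short exact sequences to the middle resolutions can be corrected by a
null-homotopic map so that it becomes compatible with the short exact sequences of resolutions. -/
theorem exists_lift_mid {S S' : ShortComplex C} (u : S ⟶ S')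
    {P : ProjectiveResolution S.X₁} {Q : ProjectiveResolution S.X₃}
    {P' : ProjectiveResolution S'.X₁} {Q' : ProjectiveResolution S'.X₃}
    (R : SequenceResolution S P Q) (R' : SequenceResolution S' P' Q') :
    ∃ m : R.mid.complex ⟶ R'.mid.complex, R.f ≫ m ≫ R'.g = 0 ∧
      m ≫ R'.mid.π = R.mid.π ≫ (ChainComplex.single₀ C).map u.τ₂ := by
  let m₀ := ProjectiveResolution.lift u.τ₂ R.mid R'.mid
  have hm₀ : m₀ ≫ R'.mid.π = R.mid.π ≫ (ChainComplex.single₀ C).map u.τ₂ :=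
    ProjectiveResolution.lift_commutes _ _ _
  -- The obstruction to `m₀` respecting the subcomplexes covers `S.f ≫ u.τ₂ ≫ S'.g = S.f ≫ S.g ≫
  -- u.τ₃ = 0`, so it is null-homotopic.
  have hz : (R.f ≫ m₀ ≫ R'.g) ≫ Q'.π = 0 := by
    rw [Category.assoc, Category.assoc, R'.g_π, reassoc_of% hm₀, reassoc_of% R.f_π,
      ← Functor.map_comp, ← Functor.map_comp, u.comm₂₃, S.zero_assoc, zero_comp,
      Functor.map_zero, comp_zero]
  let h := ProjectiveResolution.liftHomotopyZero _ hz
  choose r s hr _ _ using exists_splitting R.shortExact Q.projective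
  choose r' s' _ hs' _ using exists_splitting R'.shortExact Q'.projective
  -- The splittings need not commute with differentials, and need not: `k` only has to satisfy `R.f
  -- ≫ k ≫ R'.g = h` degreewise, while `R.f` and `R'.g` are chain maps and pass through the
  -- null-homotopic map built from `k`.
  let k : ∀ i j, R.mid.complex.X i ⟶ R'.mid.complex.X j := fun i j => r i ≫ h.hom i j ≫ s' j
  have hk : R.f ≫ Homotopy.nullHomotopicMap k ≫ R'.g = R.f ≫ m₀ ≫ R'.g := by
    rw [Homotopy.nullHomotopicMap_comp, Homotopy.comp_nullHomotopicMap]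
    ext i
    refine Eq.trans ?_ ((h.comm i).trans (add_zero _)).symm
    have : (fun i j => R.f.f i ≫ k i j ≫ R'.g.f j) = h.hom := by
      funext i j
      have h₁ : R.f.f i ≫ r i = 𝟙 _ := hr i
      have h₂ : s' j ≫ R'.g.f j = 𝟙 _ := hs' j
      simp only [k, Category.assoc, h₂, reassoc_of% h₁, Category.comp_id]
    rw [this]
    rfl
  -- In degree 0 only the term ending in `d 1 0` survives, and the augmentation kills it. So the
  -- correction does not change the map that is covered.
  have hkπ : Homotopy.nullHomotopicMap k ≫ R'.mid.π = 0 := by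
    refine HomologicalComplex.to_single_hom_ext ?_
    rw [HomologicalComplex.comp_f, Homotopy.nullHomotopicMap_f_of_not_rel_left
      (show (ComplexShape.down ℕ).Rel 1 0 from rfl) (by simp), Category.assoc,
      R'.mid.complex_d_comp_π_f_zero, comp_zero]
    rfl
  refine ⟨m₀ - Homotopy.nullHomotopicMap k, ?_, ?_⟩
  · rw [Preadditive.sub_comp, Preadditive.comp_sub, hk, sub_self]
  · rw [Preadditive.sub_comp, hkπ, sub_zero, hm₀]

/-- A morphism of short exact sequences lifts to a morphism between given short exact sequences of
projective resolutions. -/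
theorem exists_lift {S S' : ShortComplex C} (hS' : S'.ShortExact) (u : S ⟶ S')
    {P : ProjectiveResolution S.X₁} {Q : ProjectiveResolution S.X₃}
    {P' : ProjectiveResolution S'.X₁} {Q' : ProjectiveResolution S'.X₃}
    (R : SequenceResolution S P Q) (R' : SequenceResolution S' P' Q') :
    ∃ φ : R.shortComplex ⟶ R'.shortComplex,
      φ.τ₁ ≫ P'.π = P.π ≫ (ChainComplex.single₀ C).map u.τ₁ ∧
      φ.τ₃ ≫ Q'.π = Q.π ≫ (ChainComplex.single₀ C).map u.τ₃ := by
  obtain ⟨m, hm, hmπ⟩ := exists_lift_mid u R R'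
  have := R.shortExact.epi_g
  have := R'.shortExact.mono_f
  have := hS'.mono_f
  -- Since `R.f ≫ m ≫ R'.g = 0`, the map `m` restricts to the kernels and descends to the cokernels.
  let a : P.complex ⟶ P'.complex :=
    R'.shortExact.exact.lift (R.f ≫ m) ((Category.assoc _ _ _).trans hm)
  let c : Q.complex ⟶ Q'.complex := R.shortExact.exact.desc (m ≫ R'.g) hm
  have ha : a ≫ R'.f = R.f ≫ m := R'.shortExact.exact.lift_f _ _
  have hc : R.g ≫ c = m ≫ R'.g := R.shortExact.exact.g_desc _ _
  refine ⟨{ τ₁ := a, τ₂ := m, τ₃ := c, comm₁₂ := ha, comm₂₃ := hc.symm }, ?_, ?_⟩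
  -- That `a` covers `u.τ₁` may be checked after the monomorphism `S'.f`, where it follows from the
  -- statement for `m`; dually, `c` is checked after the epimorphism `R.g`.
  · refine (cancel_mono ((ChainComplex.single₀ C).map S'.f)).1 ?_
    change (a ≫ P'.π) ≫ _ = _
    rw [Category.assoc, Category.assoc, ← R'.f_π, reassoc_of% ha, hmπ, reassoc_of% R.f_π,
      ← Functor.map_comp, ← Functor.map_comp, u.comm₁₂]
  · have : Epi R.g := R.shortExact.epi_g
    refine (cancel_epi R.g).1 ?_
    change R.g ≫ c ≫ Q'.π = _
    rw [reassoc_of% hc, R'.g_π, reassoc_of% hmπ, reassoc_of% R.g_π,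
      ← Functor.map_comp, ← Functor.map_comp, u.comm₂₃]

end SequenceResolution

end Comparison

/-! ### The long exact sequence for a homotopy invariant functor on chain complexes, covering both
variables at once. -/

section LongExactSequence

variable {C : Type u₁} [Category.{v₁} C] [Abelian C]
  {E : Type u₃} [Category.{v₃} E] [Abelian E]

/-- The functor `G` on chain complexes sends homotopic maps to maps inducing the same morphisms
in homology. -/
def HomotopyInvariant (G : ChainComplex C ℕ ⥤ ChainComplex E ℕ) : Prop :=
  ∀ ⦃K K' : ChainComplex C ℕ⦄ ⦃f f' : K ⟶ K'⦄, Homotopy f f' → ∀ n : ℕ,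
    HomologicalComplex.homologyMap (G.map f) n = HomologicalComplex.homologyMap (G.map f') n

namespace HomotopyInvariant

variable {G : ChainComplex C ℕ ⥤ ChainComplex E ℕ}

/-- Lifts of a fixed morphism to projective resolutions are unique up to homotopy. This trades any
convenient lift for the one used to define `derived`. -/
theorem homologyMap_eq_lift (hG : HomotopyInvariant G) {X Y : C} {f : X ⟶ Y}
    {P : ProjectiveResolution X} {Q : ProjectiveResolution Y} {a : P.complex ⟶ Q.complex}
    (ha : a ≫ Q.π = P.π ≫ (ChainComplex.single₀ C).map f) (n : ℕ) :
    HomologicalComplex.homologyMap (G.map a) n =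
      HomologicalComplex.homologyMap (G.map (ProjectiveResolution.lift f P Q)) n :=
  hG (ProjectiveResolution.liftHomotopy f _ _ ha (ProjectiveResolution.lift_commutes f P Q)) n

/-- The homology of `G` does not depend on the choice of a projective resolution. -/
noncomputable def homologyIso (hG : HomotopyInvariant G) {X : C} (P Q : ProjectiveResolution X)
    (n : ℕ) : (G.obj P.complex).homology n ≅ (G.obj Q.complex).homology n where
  hom := HomologicalComplex.homologyMap (G.map (ProjectiveResolution.homotopyEquiv P Q).hom) n
  inv := HomologicalComplex.homologyMap (G.map (ProjectiveResolution.homotopyEquiv P Q).inv) n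
  hom_inv_id := by
    rw [← HomologicalComplex.homologyMap_comp, ← Functor.map_comp,
      hG (ProjectiveResolution.homotopyEquiv P Q).homotopyHomInvId n,
      CategoryTheory.Functor.map_id, HomologicalComplex.homologyMap_id]
  inv_hom_id := by
    rw [← HomologicalComplex.homologyMap_comp, ← Functor.map_comp,
      hG (ProjectiveResolution.homotopyEquiv P Q).homotopyInvHomId n,
      CategoryTheory.Functor.map_id, HomologicalComplex.homologyMap_id]

variable {S S' : ShortComplex C} {P : ProjectiveResolution S.X₁} {Q : ProjectiveResolution S.X₃}
  {P' : ProjectiveResolution S'.X₁} {Q' : ProjectiveResolution S'.X₃}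
  {R : SequenceResolution S P Q} {R' : SequenceResolution S' P' Q'}

/-- With `lift_g`, this identifies the maps in and out of the homology at `R.mid` with those at an
arbitrary resolution `M` of the middle object; both sides come from lifts of `S.f`. -/
theorem f_lift (hG : HomotopyInvariant G) (R : SequenceResolution S P Q)
    (M : ProjectiveResolution S.X₂) (n : ℕ) :
    HomologicalComplex.homologyMap (G.map R.f) n ≫ (hG.homologyIso R.mid M n).hom =
      HomologicalComplex.homologyMap (G.map (ProjectiveResolution.lift S.f P M)) n := by
  rw [homologyIso, ← HomologicalComplex.homologyMap_comp, ← Functor.map_comp]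
  refine hG.homologyMap_eq_lift ?_ n
  rw [Category.assoc, ProjectiveResolution.homotopyEquiv_hom_π, R.f_π]

theorem lift_g (hG : HomotopyInvariant G) (R : SequenceResolution S P Q)
    (M : ProjectiveResolution S.X₂) (n : ℕ) :
    (hG.homologyIso R.mid M n).hom ≫
        HomologicalComplex.homologyMap (G.map (ProjectiveResolution.lift S.g M Q)) n =
      HomologicalComplex.homologyMap (G.map R.g) n := by
  rw [homologyIso, ← HomologicalComplex.homologyMap_comp, ← Functor.map_comp,
    hG.homologyMap_eq_lift R.g_π n]
  refine hG.homologyMap_eq_lift ?_ n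
  rw [Category.assoc, ProjectiveResolution.lift_commutes,
    ProjectiveResolution.homotopyEquiv_hom_π_assoc]

variable [G.PreservesZeroMorphisms]

/-- The lift of `u` to the sequences of resolutions gives naturality of the homology sequence, and
its outer components are homotopic to the standard lifts. Applied to an identity, it also shows that
`δ` does not depend on the middle resolution. -/
theorem δ_naturality (hG : HomotopyInvariant G) (hS' : S'.ShortExact) (u : S ⟶ S')
    (hR : (R.shortComplex.map G).ShortExact) (hR' : (R'.shortComplex.map G).ShortExact) (n : ℕ) :
    hR.δ (n + 1) n rfl ≫
        HomologicalComplex.homologyMap (G.map (ProjectiveResolution.lift u.τ₁ P P')) n =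
      HomologicalComplex.homologyMap (G.map (ProjectiveResolution.lift u.τ₃ Q Q')) (n + 1) ≫
        hR'.δ (n + 1) n rfl := by
  obtain ⟨φ, h₁, h₃⟩ := SequenceResolution.exists_lift hS' u R R'
  rw [← hG.homologyMap_eq_lift h₁, ← hG.homologyMap_eq_lift h₃]
  exact HomologicalComplex.HomologySequence.δ_naturality (G.mapShortComplex.map φ) hR hR' _ _ _

/-- This and the next two results transport the homology sequence of `R` along `homologyIso R.mid
M`, with identities on the other terms. -/
theorem exact₂ (hG : HomotopyInvariant G) (hR : (R.shortComplex.map G).ShortExact)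
    (M : ProjectiveResolution S.X₂) (n : ℕ) :
    ExactAtMiddle (HomologicalComplex.homologyMap (G.map (ProjectiveResolution.lift S.f P M)) n)
      (HomologicalComplex.homologyMap (G.map (ProjectiveResolution.lift S.g M Q)) n) := by
  have w : HomologicalComplex.homologyMap (G.map (ProjectiveResolution.lift S.f P M)) n ≫
      HomologicalComplex.homologyMap (G.map (ProjectiveResolution.lift S.g M Q)) n = 0 := by
    rw [← hG.f_lift R, Category.assoc, hG.lift_g, ← HomologicalComplex.homologyMap_comp,
      ← Functor.map_comp, R.zero, Functor.map_zero, HomologicalComplex.homologyMap_zero]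
  refine ⟨w, ShortComplex.exact_of_iso ?_ (hR.homology_exact₂ n)⟩
  exact ShortComplex.isoMk (Iso.refl _) (hG.homologyIso R.mid M n) (Iso.refl _)
    ((Category.id_comp _).trans (hG.f_lift R M n).symm)
    ((hG.lift_g R M n).trans (Category.comp_id _).symm)

theorem exact₃ (hG : HomotopyInvariant G) (hR : (R.shortComplex.map G).ShortExact)
    (M : ProjectiveResolution S.X₂) (n : ℕ) :
    ExactAtMiddle
      (HomologicalComplex.homologyMap (G.map (ProjectiveResolution.lift S.g M Q)) (n + 1))
      (hR.δ (n + 1) n rfl) := by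
  have w : HomologicalComplex.homologyMap (G.map (ProjectiveResolution.lift S.g M Q)) (n + 1) ≫
      hR.δ (n + 1) n rfl = 0 := by
    refine (cancel_epi (hG.homologyIso R.mid M (n + 1)).hom).1 ?_
    refine (Category.assoc _ _ _).symm.trans ?_
    refine (congr_arg (· ≫ _) (hG.lift_g R M (n + 1))).trans ?_
    exact (hR.comp_δ _ _ _).trans comp_zero.symm
  refine ⟨w, ShortComplex.exact_of_iso ?_ (hR.homology_exact₃ (n + 1) n rfl)⟩
  exact ShortComplex.isoMk (hG.homologyIso R.mid M (n + 1)) (Iso.refl _) (Iso.refl _)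
    ((hG.lift_g R M (n + 1)).trans (Category.comp_id _).symm)
    ((Category.id_comp _).trans (Category.comp_id _).symm)

theorem exact₁ (hG : HomotopyInvariant G) (hR : (R.shortComplex.map G).ShortExact)
    (M : ProjectiveResolution S.X₂) (n : ℕ) :
    ExactAtMiddle (hR.δ (n + 1) n rfl)
      (HomologicalComplex.homologyMap (G.map (ProjectiveResolution.lift S.f P M)) n) := by
  have w : hR.δ (n + 1) n rfl ≫
      HomologicalComplex.homologyMap (G.map (ProjectiveResolution.lift S.f P M)) n = 0 := by
    rw [← hG.f_lift R]
    exact (Category.assoc _ _ _).symm.trans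
      ((congr_arg (· ≫ _) (hR.δ_comp _ _ _)).trans zero_comp)
  refine ⟨w, ShortComplex.exact_of_iso ?_ (hR.homology_exact₁ (n + 1) n rfl)⟩
  exact ShortComplex.isoMk (Iso.refl _) (Iso.refl _) (hG.homologyIso R.mid M n)
    ((Category.id_comp _).trans (Category.comp_id _).symm)
    ((Category.id_comp _).trans (hG.f_lift R M n).symm)

theorem epi_homologyMap_zero (hG : HomotopyInvariant G) (hR : (R.shortComplex.map G).ShortExact)
    (M : ProjectiveResolution S.X₂) :
    Epi (HomologicalComplex.homologyMap (G.map (ProjectiveResolution.lift S.g M Q)) 0) := by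
  have : Epi (G.map R.g) := hR.epi_g
  -- No differential leaves degree 0, so every element is a cycle there. Hence the epimorphism
  -- `G.map R.g` stays epi on cycles, and then on their quotient, the homology.
  have := HomologicalComplex.isIso_iCycles (G.obj R.mid.complex) 0 _ rfl (by simp)
  have := HomologicalComplex.isIso_iCycles (G.obj Q.complex) 0 _ rfl (by simp)
  have : Epi (HomologicalComplex.cyclesMap (G.map R.g) 0 ≫ (G.obj Q.complex).iCycles 0) := by
    rw [HomologicalComplex.cyclesMap_i]
    infer_instance
  have : Epi (HomologicalComplex.cyclesMap (G.map R.g) 0) :=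
    (epi_comp_iff_of_isIso _ ((G.obj Q.complex).iCycles 0)).1 this
  have : Epi ((G.obj R.mid.complex).homologyπ 0 ≫
      HomologicalComplex.homologyMap (G.map R.g) 0) := by
    rw [HomologicalComplex.homologyπ_naturality]
    infer_instance
  have : Epi (HomologicalComplex.homologyMap (G.map R.g) 0) :=
    epi_of_epi ((G.obj R.mid.complex).homologyπ 0) _
  rw [← hG.lift_g R M] at this
  exact epi_of_epi (hG.homologyIso R.mid M 0).hom _

end HomotopyInvariant

theorem δ_natTrans {G G' : ChainComplex C ℕ ⥤ ChainComplex E ℕ} [G.PreservesZeroMorphisms]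
    [G'.PreservesZeroMorphisms] (α : G ⟶ G') {T : ShortComplex (ChainComplex C ℕ)}
    (hT : (T.map G).ShortExact) (hT' : (T.map G').ShortExact) (n : ℕ) :
    hT.δ (n + 1) n rfl ≫ HomologicalComplex.homologyMap (α.app T.X₁) n =
      HomologicalComplex.homologyMap (α.app T.X₃) (n + 1) ≫ hT'.δ (n + 1) n rfl :=
  HomologicalComplex.HomologySequence.δ_naturality (T.mapNatTrans α) hT hT' _ _ _

end LongExactSequence

/-! ### Pointwise exactness in functor categories. -/

section FunctorCategory

variable {K : Type t₁} [Category.{w₁} K] {E : Type u₃} [Category.{v₃} E] [Abelian E]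

/-- Evaluation at an object is exact, so it commutes with homology, and a functor is zero once all
its values are. -/
theorem exactAtMiddle_of_app {X Y Z : K ⥤ E} (f : X ⟶ Y) (g : Y ⟶ Z)
    (h : ∀ k, ExactAtMiddle (f.app k) (g.app k)) : ExactAtMiddle f g := by
  have w : f ≫ g = 0 := by
    ext k
    exact (h k).1
  refine ⟨w, ?_⟩
  rw [ShortComplex.exact_iff_isZero_homology, Functor.isZero_iff]
  intro k
  refine IsZero.of_iso ?_ ((ShortComplex.mk f g w).mapHomologyIso ((evaluation K E).obj k)).symm
  rw [← ShortComplex.exact_iff_isZero_homology]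
  exact (h k).2

end FunctorCategory

/-! ### Homotopy invariance of the total complex in each variable. -/

section Total

variable {C : Type u₁} [Category.{v₁} C] [Abelian C]
  {D : Type u₂} [Category.{v₂} D] [Abelian D]
  {E : Type u₃} [Category.{v₃} E] [Abelian E]
  (F : C ⥤ D ⥤ E) [F.Additive] [∀ X, (F.obj X).Additive]

theorem homotopyInvariant_tot_left (L : ChainComplex D ℕ) :
    HomotopyInvariant ((tot F).flip.obj L) :=
  fun _ _ _ _ h n => homologyMap_tot_left F h L n

theorem homotopyInvariant_tot_right (K : ChainComplex C ℕ) :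
    HomotopyInvariant ((tot F).obj K) :=
  fun _ _ _ _ h n => homologyMap_tot_right F K h n

end Total

/-! ### Squares that commute by bifunctoriality. -/

section Bimap

variable {C : Type u₁} [Category.{v₁} C] {D : Type u₂} [Category.{v₂} D]
  {E : Type u₃} [Category.{v₃} E]

theorem bimap_naturality_left (G : C ⥤ D ⥤ E) {X X' Y Y' : C}
    {a : X ⟶ X'} {b : Y ⟶ Y'} {p : X ⟶ Y} {q : X' ⟶ Y'}
    (h : p ≫ b = a ≫ q) {A B : D} (f : A ⟶ B) :
    (G.map p).app A ≫ bimap G b f = bimap G a f ≫ (G.map q).app B := by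
  simp only [bimap, Category.assoc, NatTrans.naturality]
  simp only [← Category.assoc, ← NatTrans.comp_app, ← Functor.map_comp, h]

theorem bimap_naturality_right (G : C ⥤ D ⥤ E) {X X' Y Y' : D}
    {a : X ⟶ X'} {b : Y ⟶ Y'} {p : X ⟶ Y} {q : X' ⟶ Y'}
    (h : p ≫ b = a ≫ q) {A B : C} (f : A ⟶ B) :
    (G.obj A).map p ≫ bimap G f b = bimap G f a ≫ (G.obj B).map q := by
  simp only [bimap, Category.assoc, NatTrans.naturality_assoc]
  simp only [← Functor.map_comp, h]

end Bimap

/-! ### Naturality of the connecting morphisms in both variables, and their extension to exponents.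
-/

section Bifunctor

variable {C : Type u₁} [Category.{v₁} C] [Abelian C] [EnoughProjectives C]
  {D : Type u₂} [Category.{v₂} D] [Abelian D] [EnoughProjectives D]
  {E : Type u₃} [Category.{v₃} E] [Abelian E]
  (F : C ⥤ D ⥤ E) [F.Additive] [∀ X, (F.obj X).Additive]

theorem connectingLeft_naturality {S S' : ShortComplex C} (hS : S.ShortExact)
    (hS' : S'.ShortExact) (u : S ⟶ S') {A B : D} (f : A ⟶ B) (n : ℕ) :
    connectingLeft F hS A n ≫ bimap (derived F n) u.τ₁ f =
      bimap (derived F (n + 1)) u.τ₃ f ≫ connectingLeft F hS' B n := by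
  -- `bimap` acts first in the first variable, so the passage from `A` to `B` takes place over `S'`
  -- and uses its resolution.
  let R' := (nonempty_sequenceResolution hS'
    (projectiveResolution S'.X₁) (projectiveResolution S'.X₃)).some
  have h₁ : connectingLeft F hS A n ≫ ((derived F n).map u.τ₁).app A =
      ((derived F (n + 1)).map u.τ₃).app A ≫ connectingLeft F hS' A n :=
    (homotopyInvariant_tot_left F _).δ_naturality hS' u _ _ n
  have h₂ : connectingLeft F hS' A n ≫ ((derived F n).obj S'.X₁).map f =
      ((derived F (n + 1)).obj S'.X₃).map f ≫ connectingLeft F hS' B n :=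
    δ_natTrans ((tot F).flip.map
      (ProjectiveResolution.lift f (projectiveResolution A) (projectiveResolution B)))
      (T := R'.shortComplex) _ _ n
  rw [bimap, bimap, reassoc_of% h₁, h₂, Category.assoc]

theorem connectingRight_naturality {A B : C} (f : A ⟶ B) {S S' : ShortComplex D}
    (hS : S.ShortExact) (hS' : S'.ShortExact) (u : S ⟶ S') (n : ℕ) :
    connectingRight F A hS n ≫ bimap (derived F n) f u.τ₁ =
      bimap (derived F (n + 1)) f u.τ₃ ≫ connectingRight F B hS' n := by
  -- Here the passage from `A` to `B` comes first, so it takes place over `S`, before the sequence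
  -- is changed.
  let R := (nonempty_sequenceResolution hS
    (projectiveResolution S.X₁) (projectiveResolution S.X₃)).some
  have h₁ : connectingRight F B hS n ≫ ((derived F n).obj B).map u.τ₁ =
      ((derived F (n + 1)).obj B).map u.τ₃ ≫ connectingRight F B hS' n :=
    (homotopyInvariant_tot_right F _).δ_naturality hS' u _ _ n
  have h₂ : connectingRight F A hS n ≫ ((derived F n).map f).app S.X₁ =
      ((derived F (n + 1)).map f).app S.X₃ ≫ connectingRight F B hS n :=
    δ_natTrans ((tot F).map
      (ProjectiveResolution.lift f (projectiveResolution A) (projectiveResolution B)))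
      (T := R.shortComplex) _ _ n
  rw [bimap, bimap, reassoc_of% h₂, h₁, Category.assoc]

variable {I : Type t₁} [Category.{w₁} I] {J : Type t₂} [Category.{w₂} J]

/-- The connecting morphism of the exponent of the derived bifunctors, in the first variable. -/
noncomputable def exponentConnectingLeft (S : ShortComplex (I ⥤ C)) (hS : S.ShortExact)
    (A : J ⥤ D) (n : ℕ) :
    ((exponent (derived F (n + 1)) I J).obj S.X₃).obj A ⟶
      ((exponent (derived F n) I J).obj S.X₁).obj A where
  app k := connectingLeft F (hS.map_of_exact ((evaluation I C).obj k.1)) (A.obj k.2) n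
  -- An arrow of `I` gives a morphism between component sequences of `S`, and an arrow of `J` a
  -- morphism between components of `A`, so this is the two-variable naturality.
  naturality {k l} a := (connectingLeft_naturality F
    (hS.map_of_exact ((evaluation I C).obj k.1)) (hS.map_of_exact ((evaluation I C).obj l.1))
    (S.mapNatTrans ((evaluation I C).map a.1)) (A.map a.2) n).symm

/-- The connecting morphism of the exponent of the derived bifunctors, in the second variable. -/
noncomputable def exponentConnectingRight (A : I ⥤ C) (S : ShortComplex (J ⥤ D))
    (hS : S.ShortExact) (n : ℕ) :
    ((exponent (derived F (n + 1)) I J).obj A).obj S.X₃ ⟶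
      ((exponent (derived F n) I J).obj A).obj S.X₁ where
  app k := connectingRight F (A.obj k.1) (hS.map_of_exact ((evaluation J D).obj k.2)) n
  naturality {k l} a := (connectingRight_naturality F (A.map a.1)
    (hS.map_of_exact ((evaluation J D).obj k.2)) (hS.map_of_exact ((evaluation J D).obj l.2))
    (S.mapNatTrans ((evaluation J D).map a.2)) n).symm

end Bifunctor

end BifunctorHomology

/-! ### Assembly of the components. -/

theorem mainTheorem4
    {C : Type u₁} [Category.{v₁} C] [Abelian C] [EnoughProjectives C]
    {D : Type u₂} [Category.{v₂} D] [Abelian D] [EnoughProjectives D]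
    {E : Type u₃} [Category.{v₃} E] [Abelian E]
    (F : C ⥤ D ⥤ E) [F.Additive] [∀ X : C, (F.obj X).Additive]
    [∀ X : C, PreservesFiniteColimits (F.obj X)]
    [∀ Y : D, PreservesFiniteColimits (F.flip.obj Y)]
    (I : Type t₁) [Category.{w₁} I] (J : Type t₂) [Category.{w₂} J] :
    -- `T n` is the functor `F_n^{I × J} : C^I × D^J ⥤ E^{I × J}`
    let T : ℕ → ((I ⥤ C) ⥤ (J ⥤ D) ⥤ (I × J ⥤ E)) :=
      fun n => BifunctorHomology.exponent (BifunctorHomology.derived F n) I J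
    -- short exact sequences in the first variable
    (∃ δ : ∀ (S : ShortComplex (I ⥤ C)) (_ : S.ShortExact) (A : J ⥤ D) (n : ℕ),
        ((T (n + 1)).obj S.X₃).obj A ⟶ ((T n).obj S.X₁).obj A,
      -- the components of `δ` are the connecting morphisms of the component sequences
      (∀ (S : ShortComplex (I ⥤ C)) (hS : S.ShortExact) (A : J ⥤ D) (n : ℕ) (i : I) (j : J),
        (δ S hS A n).app (i, j) =
          BifunctorHomology.connectingLeft F
            (hS.map_of_exact ((evaluation I C).obj i)) (A.obj j) n) ∧
      -- the rows are exact
      (∀ (S : ShortComplex (I ⥤ C)) (hS : S.ShortExact) (A : J ⥤ D),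
        (∀ n, BifunctorHomology.ExactAtMiddle
          (((T n).map S.f).app A) (((T n).map S.g).app A)) ∧
        (∀ n, BifunctorHomology.ExactAtMiddle
          (((T (n + 1)).map S.g).app A) (δ S hS A n)) ∧
        (∀ n, BifunctorHomology.ExactAtMiddle
          (δ S hS A n) (((T n).map S.f).app A)) ∧
        Epi (((T 0).map S.g).app A)) ∧
      -- the squares commute
      (∀ (S S' : ShortComplex (I ⥤ C)) (hS : S.ShortExact) (hS' : S'.ShortExact) (u : S ⟶ S')
        (A B : J ⥤ D) (f : A ⟶ B) (n : ℕ),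
        ((T n).map S.f).app A ≫ BifunctorHomology.bimap (T n) u.τ₂ f =
          BifunctorHomology.bimap (T n) u.τ₁ f ≫ ((T n).map S'.f).app B ∧
        ((T n).map S.g).app A ≫ BifunctorHomology.bimap (T n) u.τ₃ f =
          BifunctorHomology.bimap (T n) u.τ₂ f ≫ ((T n).map S'.g).app B ∧
        δ S hS A n ≫ BifunctorHomology.bimap (T n) u.τ₁ f =
          BifunctorHomology.bimap (T (n + 1)) u.τ₃ f ≫ δ S' hS' B n)) ∧
    -- short exact sequences in the second variable
    (∃ δ : ∀ (A : I ⥤ C) (S : ShortComplex (J ⥤ D)) (_ : S.ShortExact) (n : ℕ),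
        ((T (n + 1)).obj A).obj S.X₃ ⟶ ((T n).obj A).obj S.X₁,
      (∀ (A : I ⥤ C) (S : ShortComplex (J ⥤ D)) (hS : S.ShortExact) (n : ℕ) (i : I) (j : J),
        (δ A S hS n).app (i, j) =
          BifunctorHomology.connectingRight F (A.obj i)
            (hS.map_of_exact ((evaluation J D).obj j)) n) ∧
      (∀ (A : I ⥤ C) (S : ShortComplex (J ⥤ D)) (hS : S.ShortExact),
        (∀ n, BifunctorHomology.ExactAtMiddle
          (((T n).obj A).map S.f) (((T n).obj A).map S.g)) ∧
        (∀ n, BifunctorHomology.ExactAtMiddle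
          (((T (n + 1)).obj A).map S.g) (δ A S hS n)) ∧
        (∀ n, BifunctorHomology.ExactAtMiddle
          (δ A S hS n) (((T n).obj A).map S.f)) ∧
        Epi (((T 0).obj A).map S.g)) ∧
      (∀ (A B : I ⥤ C) (f : A ⟶ B) (S S' : ShortComplex (J ⥤ D)) (hS : S.ShortExact)
        (hS' : S'.ShortExact) (u : S ⟶ S') (n : ℕ),
        ((T n).obj A).map S.f ≫ BifunctorHomology.bimap (T n) f u.τ₂ =
          BifunctorHomology.bimap (T n) f u.τ₁ ≫ ((T n).obj B).map S'.f ∧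
        ((T n).obj A).map S.g ≫ BifunctorHomology.bimap (T n) f u.τ₃ =
          BifunctorHomology.bimap (T n) f u.τ₂ ≫ ((T n).obj B).map S'.g ∧
        δ A S hS n ≫ BifunctorHomology.bimap (T n) f u.τ₁ =
          BifunctorHomology.bimap (T (n + 1)) f u.τ₃ ≫ δ B S' hS' n)) := by
  intro T
  refine ⟨⟨BifunctorHomology.exponentConnectingLeft F, fun _ _ _ _ _ _ => rfl, fun S hS A => ?_,
    fun S S' hS hS' u A B f n => ⟨BifunctorHomology.bimap_naturality_left _ u.comm₁₂.symm f,
      BifunctorHomology.bimap_naturality_left _ u.comm₂₃.symm f, ?_⟩⟩,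
    ⟨BifunctorHomology.exponentConnectingRight F, fun _ _ _ _ _ _ => rfl, fun A S hS => ?_,
    fun A B f S S' hS hS' u n => ⟨BifunctorHomology.bimap_naturality_right _ u.comm₁₂.symm f,
      BifunctorHomology.bimap_naturality_right _ u.comm₂₃.symm f, ?_⟩⟩⟩
  · have hG := fun k : I × J => BifunctorHomology.homotopyInvariant_tot_left F
      (projectiveResolution (A.obj k.2)).complex
    -- The same choice as in `connectingLeft`, so that the `δ` of `hR k` is the component of the
    -- connecting morphism by definition.
    let R := fun k : I × J => (BifunctorHomology.nonempty_sequenceResolution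
      (hS.map_of_exact ((evaluation I C).obj k.1))
      (projectiveResolution (S.X₁.obj k.1)) (projectiveResolution (S.X₃.obj k.1))).some
    have hR := fun k : I × J => BifunctorHomology.tot_shortExact_left F (R k).shortExact
      (projectiveResolution (S.X₃.obj k.1)).projective (projectiveResolution (A.obj k.2)).complex
    refine ⟨fun n => BifunctorHomology.exactAtMiddle_of_app _ _ fun k =>
        (hG k).exact₂ (hR k) (projectiveResolution (S.X₂.obj k.1)) n,
      fun n => BifunctorHomology.exactAtMiddle_of_app _ _ fun k =>
        (hG k).exact₃ (hR k) (projectiveResolution (S.X₂.obj k.1)) n,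
      fun n => BifunctorHomology.exactAtMiddle_of_app _ _ fun k =>
        (hG k).exact₁ (hR k) (projectiveResolution (S.X₂.obj k.1)) n, ?_⟩
    -- As `F_{-1} = 0`, exactness at the last term `F_0(N, A)` means that the map onto it is epi.
    have : ∀ k, Epi ((((T 0).map S.g).app A).app k) := fun k =>
      (hG k).epi_homologyMap_zero (hR k) (projectiveResolution (S.X₂.obj k.1))
    exact NatTrans.epi_of_epi_app _
  · ext k
    exact BifunctorHomology.connectingLeft_naturality F
      (hS.map_of_exact ((evaluation I C).obj k.1)) (hS'.map_of_exact ((evaluation I C).obj k.1))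
      (((evaluation I C).obj k.1).mapShortComplex.map u) (f.app k.2) n
  · have hG := fun k : I × J => BifunctorHomology.homotopyInvariant_tot_right F
      (projectiveResolution (A.obj k.1)).complex
    -- Again the choice made in `connectingRight`; the general results now apply to `Tot F(K, -)`
    -- with `K` the resolution of `A.obj k.1`.
    let R := fun k : I × J => (BifunctorHomology.nonempty_sequenceResolution
      (hS.map_of_exact ((evaluation J D).obj k.2))
      (projectiveResolution (S.X₁.obj k.2)) (projectiveResolution (S.X₃.obj k.2))).some
    have hR := fun k : I × J => BifunctorHomology.tot_shortExact_right F (R k).shortExact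
      (projectiveResolution (S.X₃.obj k.2)).projective (projectiveResolution (A.obj k.1)).complex
    refine ⟨fun n => BifunctorHomology.exactAtMiddle_of_app _ _ fun k =>
        (hG k).exact₂ (hR k) (projectiveResolution (S.X₂.obj k.2)) n,
      fun n => BifunctorHomology.exactAtMiddle_of_app _ _ fun k =>
        (hG k).exact₃ (hR k) (projectiveResolution (S.X₂.obj k.2)) n,
      fun n => BifunctorHomology.exactAtMiddle_of_app _ _ fun k =>
        (hG k).exact₁ (hR k) (projectiveResolution (S.X₂.obj k.2)) n, ?_⟩
    have : ∀ k, Epi ((((T 0).obj A).map S.g).app k) := fun k =>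
      (hG k).epi_homologyMap_zero (hR k) (projectiveResolution (S.X₂.obj k.2))
    exact NatTrans.epi_of_epi_app _
  · ext k
    exact BifunctorHomology.connectingRight_naturality F (f.app k.1)
      (hS.map_of_exact ((evaluation J D).obj k.2)) (hS'.map_of_exact ((evaluation J D).obj k.2))
      (((evaluation J D).obj k.2).mapShortComplex.map u) n
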